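/- Let $X$ be a finite non-empty set, $I=[0,1]$, $\mathcal P(X)$ the power set of $X$ and $\widetilde{\mathcal P}(X)$ the set of fuzzy sets $A:X\to I$. An $n$-ary semi-fuzzy (resp. fuzzy) quantifier on $X$ is a map $\mathcal P(X)^n\to I$ (resp. $\widetilde{\mathcal P}(X)^n\to I$). A quantifier fuzzification mechanism (QFM) $\mathcal F$ assigns to every semi-fuzzy quantifier $Q$ on every finite non-empty base set a fuzzy quantifier $\mathcal F(Q)$ of the same arity on the same base set. It extends truth functions $f:\{0,1\}^n\to I$ ($n\ge 1$) to $\tilde f:I^n\to I$ by identifying $\{0,1\}^n$ with $\mathcal P(\{1,\dots,n\})$ and $I^n$ with $\widetilde{\mathcal P}(\{1,\dots,n\})$; this gives the induced $\tilde\neg,\tilde\vee$, and pointwise the fuzzy complement $\tilde\neg A$ and the fuzzy union $A\,\tilde\cup\,B$. For $f:X'\to X$ put $\hat{\mathcal F}(f)(A)(x):=\mathcal F(S\mapsto[x\in f(S)])(A)$, where $[p]\in\{0,1\}$ is the truth value of $p$. $\mathcal F$ is a determiner fuzzification scheme (DFS) if, for all finite non-empty base sets $X,X'$ and all semi-fuzzy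 quantifiers $Q$ on $X$: 1. if $n\le 1$, $\mathcal F(Q)$ agrees with $Q$ on crisp arguments; 2. for $e\in X$, if $Q(Y)=[e\in Y]$ then $\mathcal F(Q)(A)=A(e)$; 3. if $n>0$ and $Q'(Y_1,\dots,Y_n)=\tilde\neg\,Q(Y_1,\dots,Y_{n-1},X\setminus Y_n)$, then $\mathcal F(Q')(A_1,\dots,A_n)=\tilde\neg\,\mathcal F(Q)(A_1,\dots,A_{n-1},\tilde\neg A_n)$; 4. if $n>0$ and $Q'(Y_1,\dots,Y_{n+1})=Q(Y_1,\dots,Y_{n-1},Y_n\cup Y_{n+1})$, then $\mathcal F(Q')(A_1,\dots,A_{n+1})=\mathcal F(Q)(A_1,\dots,A_{n-1},A_n\,\tilde\cup\,A_{n+1})$; 5. if $n>0$ and $Q$ is non-increasing in its $n$-th argument, then so is $\mathcal F(Q)$; 6. for $f_1,\dots,f_n:X'\to X$, if $Q'(Y_1,\dots,Y_n)=Q(f_1(Y_1),\dots,f_n(Y_n))$, then $\mathcal F(Q')(A_1,\dots,A_n)=\mathcal F(Q)(\hat{\mathcal F}(f_1)(A_1),\dots,\hat{\mathcal F}(f_n)(A_n))$.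 Let $\Lambda:I\to I$ be a RIM quantifier, i.e. non-decreasing with $\Lambda(0)=0$ and $\Lambda(1)=1$. For $A,B\in\mathcal P(X)$ put $$Q^{\rightarrow}_\Lambda(A,B)=\Lambda\!\left(\frac{|X\setminus A|+|A\cap B|}{|X|}\right),\qquad Q^2_\Lambda(A,B)=\Lambda\!\left(\frac{|A\cap B|}{|A|}\right)\ (A\neq\emptyset),\qquad Q^2_\Lambda(\emptyset,B)=c,$$ where $c\in[0,1]$ is an arbitrary constant. For $A\in\widetilde{\mathcal P}(X)$ let $A^{\min}_\gamma=\{x: A(x)\ge\frac{1+\gamma}2\}$ and $A^{\max}_\gamma=\{x: A(x)>\frac{1-\gamma}2\}$ for $0<\gamma\le 1$, and $A^{\min}_0=\{x: A(x)>\frac12\}$, $A^{\max}_0=\{x: A(x)\ge\frac12\}$. The QFM $\mathcal F_{owa}$ is $$\mathcal F_{owa}(Q)(A_1,\dots,A_n)=\int_0^1\frac{\top(\gamma)+\bot(\gamma)}2\,d\gamma,$$ where $\top(\gamma)$ and $\bot(\gamma)$ are the supremum and the infimum of $Q(B_1,\dots,B_n)$ over all crisp $B_i$ with $(A_i)^{\min}_\gamma\subseteq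 B_i\subseteq (A_i)^{\max}_\gamma$ for all $i$. Finally let $\mathcal I_{KD}(a,b)=\max(1-a,b)$ be the Kleene–Dienes implicator and let $$\widetilde Y^{\mathcal I_{KD}}_\Lambda(A,B)=\int \mathcal I_{KD}(A,B)\,d\mu_\Lambda,\qquad \mu_\Lambda(S)=\Lambda(|S|/|X|),$$ where, for $f:X\to\mathbb R$ and an ordering $X=\{x_1,\dots,x_n\}$ with $f(x_1)\le\dots\le f(x_n)$, the Choquet integral is $\int f\,d\mu=\sum_{i=1}^n\mu(\{x_i,\dots,x_n\})\,(f(x_i)-f(x_{i-1}))$, $f(x_0):=0$. Then: (a) for every DFS $\mathcal F$ and all $A,B\in\widetilde{\mathcal P}(X)$, $$\mathcal F(Q^{\rightarrow}_\Lambda)(A,B)\ \ge\ \mathcal F(Q^2_\Lambda)(A,B);$$ (b) for all $A,B\in\widetilde{\mathcal P}(X)$, $$\widetilde Y^{\mathcal I_{KD}}_\Lambda(A,B)\ \ge\ \mathcal F_{owa}(Q^2_\Lambda)(A,B).$$ -/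

import Mathlib

open Set

universe u

noncomputable section

namespace FuzzyQuant

open scoped Classical unitInterval

/-! ### Fuzzy sets and quantifiers -/

/-- Fuzzy sets on `X`. -/
abbrev FuzzySet (X : Type u) := X → I

/-- `n`-ary semi-fuzzy quantifiers on `X`: crisp arguments, values in `[0,1]`. -/
abbrev SemiFuzzyQuantifier (X : Type u) (n : ℕ) := (Fin n → Set X) → I

/-- `n`-ary fuzzy quantifiers on `X`. -/
abbrev FuzzyQuantifier (X : Type u) (n : ℕ) := (Fin n → FuzzySet X) → I

/-- The truth value `1` or `0` of a proposition. -/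
def truthVal (p : Prop) : I := if p then 1 else 0

/-- A crisp set seen as a fuzzy set. -/
def crisp {X : Type u} (S : Set X) : FuzzySet X := fun x => truthVal (x ∈ S)

/-- A quantifier fuzzification mechanism: it assigns to each semi-fuzzy quantifier of any arity on
any finite non-empty base set a fuzzy quantifier of the same arity on the same base set. -/
structure QFM where
  app : ∀ {X : Type u} [Finite X] [Nonempty X] {n : ℕ},
    SemiFuzzyQuantifier X n → FuzzyQuantifier X n

namespace QFM

variable (F : QFM.{u})

/-- The fuzzy truth function `[0,1]ⁿ → [0,1]` induced by `f : {0,1}ⁿ → [0,1]` (`n ≥ 1`): identify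
`{0,1}ⁿ` with the crisp subsets and `[0,1]ⁿ` with the fuzzy subsets of an `n`-element set. -/
def truthFun {n : ℕ} [NeZero n] (f : (Fin n → Prop) → I) : (Fin n → I) → I := fun x =>
  F.app (X := ULift.{u} (Fin n)) (n := 1)
    (fun Y => f (fun i => ULift.up i ∈ Y 0)) (fun _ e => x e.down)

/-- The induced negation. -/
def neg (x : I) : I := F.truthFun (n := 1) (fun p => truthVal (¬ p 0)) ![x]

/-- The induced disjunction. -/
def disj (x y : I) : I := F.truthFun (n := 2) (fun p => truthVal (p 0 ∨ p 1)) ![x, y]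

/-- The induced fuzzy complement. -/
def compl {X : Type u} (A : FuzzySet X) : FuzzySet X := fun x => F.neg (A x)

/-- The induced fuzzy union. -/
def union {X : Type u} (A B : FuzzySet X) : FuzzySet X := fun x => F.disj (A x) (B x)

/-- The induced extension principle: the fuzzy image map of `f : X → X'`, obtained by applying the
QFM to the unary quantifiers `S ↦ (y ∈ f(S))`. -/
def image {X X' : Type u} [Finite X] [Nonempty X] (f : X → X') (A : FuzzySet X) : FuzzySet X' :=
  fun y => F.app (n := 1) (fun S : Fin 1 → Set X => truthVal (y ∈ f '' S 0)) (fun _ => A)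

/-- Determiner fuzzification schemes: the six DFS axioms (the conditions "`n > 0`" are expressed by
writing the arity as `n + 1`). -/
structure IsDFS : Prop where
  /-- Correct generalisation, for arities `n ≤ 1`. -/
  correct_generalisation : ∀ {X : Type u} [Finite X] [Nonempty X] {n : ℕ}, n ≤ 1 →
    ∀ (Q : SemiFuzzyQuantifier X n) (Y : Fin n → Set X),
      F.app Q (fun i => crisp (Y i)) = Q Y
  /-- Projection quantifiers. -/
  projection : ∀ {X : Type u} [Finite X] [Nonempty X] (e : X) (A : Fin 1 → FuzzySet X),
    F.app (fun Y : Fin 1 → Set X => truthVal (e ∈ Y 0)) A = A 0 e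
  /-- Dualisation: negate the quantifier and complement its last argument. -/
  dualisation : ∀ {X : Type u} [Finite X] [Nonempty X] {n : ℕ}
    (Q : SemiFuzzyQuantifier X (n + 1)) (A : Fin (n + 1) → FuzzySet X),
      F.app (fun Y => F.neg (Q (Function.update Y (Fin.last n) (Y (Fin.last n))ᶜ))) A =
        F.neg (F.app Q (Function.update A (Fin.last n) (F.compl (A (Fin.last n)))))
  /-- Internal joins: replace the last argument by the union of two arguments. -/
  internal_joins : ∀ {X : Type u} [Finite X] [Nonempty X] {n : ℕ}
    (Q : SemiFuzzyQuantifier X (n + 1)) (A : Fin (n + 2) → FuzzySet X),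
      F.app (fun Y : Fin (n + 2) → Set X =>
          Q (Function.update (fun i => Y i.castSucc) (Fin.last n)
            (Y (Fin.last n).castSucc ∪ Y (Fin.last (n + 1))))) A =
        F.app Q (Function.update (fun i => A i.castSucc) (Fin.last n)
          (F.union (A (Fin.last n).castSucc) (A (Fin.last (n + 1)))))
  /-- Preservation of monotonicity: if `Q` is non-increasing in its last argument, so is `F(Q)`. -/
  preserves_monotonicity : ∀ {X : Type u} [Finite X] [Nonempty X] {n : ℕ}
    (Q : SemiFuzzyQuantifier X (n + 1)),
      (∀ (Y : Fin (n + 1) → Set X) (S T : Set X), S ⊆ T →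
        Q (Function.update Y (Fin.last n) T) ≤ Q (Function.update Y (Fin.last n) S)) →
      ∀ (A : Fin (n + 1) → FuzzySet X) (B C : FuzzySet X), B ≤ C →
        F.app Q (Function.update A (Fin.last n) C) ≤ F.app Q (Function.update A (Fin.last n) B)
  /-- Functional application. -/
  functional_application : ∀ {X X' : Type u} [Finite X] [Nonempty X] [Finite X'] [Nonempty X']
    {n : ℕ} (Q : SemiFuzzyQuantifier X n) (f : Fin n → X' → X) (A : Fin n → FuzzySet X'),
      F.app (fun Y : Fin n → Set X' => Q (fun i => f i '' Y i)) A =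
        F.app Q (fun i => F.image (f i) (A i))

end QFM

/-! ### RIM quantifiers and the proportional semi-fuzzy quantifiers -/

/-- Regular increasing monotone quantifiers. -/
structure RIMQuantifier where
  toFun : I → I
  monotone : Monotone toFun
  map_zero : toFun 0 = 0
  map_one : toFun 1 = 1

/-- The quotient `k / m ∈ [0,1]` of natural numbers `k ≤ m`. -/
def frac (k m : ℕ) (h : k ≤ m) : I :=
  ⟨(k : ℝ) / m, by positivity, div_le_one_of_le₀ (by exact_mod_cast h) (by positivity)⟩

/-- `Q_Λ(S) = Λ(|S| / |X|)`, which is also the symmetric monotone measure `μ_Λ`. -/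
def propUnary {X : Type u} [Finite X] (Λ : RIMQuantifier) (S : Set X) : I :=
  Λ.toFun (frac S.ncard (Nat.card X) (Set.ncard_le_card S))

/-- `Q²_Λ(A, B) = Λ(|A ∩ B| / |A|)`, where `c` is the value given to it when `A = ∅`
(and the quotient is `0 / 0`). -/
def propBinary {X : Type u} [Finite X] (Λ : RIMQuantifier) (c : I) : SemiFuzzyQuantifier X 2 :=
  fun Y => if Y 0 = ∅ then c else
    Λ.toFun (frac (Y 0 ∩ Y 1).ncard (Y 0).ncard (Set.ncard_le_ncard Set.inter_subset_left))

/-- `Q^→_Λ(A, B) = Λ((|¬A| + |A ∩ B|) / |X|)`. -/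
def propImp {X : Type u} [Finite X] (Λ : RIMQuantifier) : SemiFuzzyQuantifier X 2 :=
  fun Y => Λ.toFun (frac ((Y 0)ᶜ.ncard + (Y 0 ∩ Y 1).ncard) (Nat.card X) (by
    have h := Set.ncard_add_ncard_compl (Y 0)
    have h' : (Y 0 ∩ Y 1).ncard ≤ (Y 0).ncard := Set.ncard_le_ncard Set.inter_subset_left
    omega))

/-! ### Choquet integral and Yager's models -/

/-- An enumeration of `X` along which `f` is non-decreasing. -/
def sortedEnum {X : Type u} [Finite X] (f : X → ℝ) : Fin (Nat.card X) ≃ X :=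
  (Tuple.sort (f ∘ (Finite.equivFin X).symm)).trans (Finite.equivFin X).symm

theorem monotone_sortedEnum {X : Type u} [Finite X] (f : X → ℝ) :
    Monotone (f ∘ sortedEnum f) :=
  Tuple.monotone_sort (f ∘ (Finite.equivFin X).symm)

/-- The Choquet integral `∑ᵢ μ({xᵢ, …, xₙ}) (f(xᵢ) - f(xᵢ₋₁))`, where `f(x₁) ≤ ⋯ ≤ f(xₙ)` and
`f(x₀) := 0`. -/
def choquet {X : Type u} [Finite X] (μ : Set X → I) (f : X → ℝ) : ℝ :=
  ∑ i : Fin (Nat.card X), (μ (sortedEnum f '' Set.Ici i) : ℝ) *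
    (f (sortedEnum f i) -
      if i.val = 0 then 0 else f (sortedEnum f ⟨i.val - 1, by omega⟩))

/-- Yager's unary model: the Choquet integral of `A` with respect to `μ_Λ`. -/
def yagerUnary {X : Type u} [Finite X] (Λ : RIMQuantifier) (A : FuzzySet X) : ℝ :=
  choquet (propUnary Λ) (fun x => (A x : ℝ))

/-- Yager's implication-based binary model. -/
def yagerBinary {X : Type u} [Finite X] (J : I → I → I) (Λ : RIMQuantifier)
    (A B : FuzzySet X) : ℝ :=
  yagerUnary Λ (fun x => J (A x) (B x))

/-- The Kleene-Dienes implicator `max(1 - x, y)`. -/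
def kleeneDienes (x y : I) : I := max (unitInterval.symm x) y

/-! ### The QFM `F_owa` -/

/-- The lower set of the three-valued cut at `γ ∈ [0,1]`. -/
def cutMin {X : Type u} (A : FuzzySet X) (γ : ℝ) : Set X :=
  if 0 < γ then {x | (1 + γ) / 2 ≤ (A x : ℝ)} else {x | 1 / 2 < (A x : ℝ)}

/-- The upper set of the three-valued cut at `γ ∈ [0,1]`. -/
def cutMax {X : Type u} (A : FuzzySet X) (γ : ℝ) : Set X :=
  if 0 < γ then {x | (1 - γ) / 2 < (A x : ℝ)} else {x | 1 / 2 ≤ (A x : ℝ)}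

/-- The values of `Q` on tuples of crisp sets in the three-valued cuts at `γ`. -/
def cutValues {X : Type u} {n : ℕ} (Q : SemiFuzzyQuantifier X n) (A : Fin n → FuzzySet X)
    (γ : ℝ) : Set ℝ :=
  {r | ∃ B : Fin n → Set X, (∀ i, cutMin (A i) γ ⊆ B i ∧ B i ⊆ cutMax (A i) γ) ∧ r = Q B}

def topVal {X : Type u} {n : ℕ} (Q : SemiFuzzyQuantifier X n) (A : Fin n → FuzzySet X)
    (γ : ℝ) : ℝ := sSup (cutValues Q A γ)

def botVal {X : Type u} {n : ℕ} (Q : SemiFuzzyQuantifier X n) (A : Fin n → FuzzySet X)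
    (γ : ℝ) : ℝ := sInf (cutValues Q A γ)

theorem topVal_mem {X : Type u} {n : ℕ} (Q : SemiFuzzyQuantifier X n) (A : Fin n → FuzzySet X)
    (γ : ℝ) : 0 ≤ topVal Q A γ ∧ topVal Q A γ ≤ 1 := by
  constructor
  · apply Real.sSup_nonneg
    rintro r ⟨B, -, rfl⟩
    exact (Q B).2.1
  · apply Real.sSup_le _ zero_le_one
    rintro r ⟨B, -, rfl⟩
    exact (Q B).2.2

theorem botVal_mem {X : Type u} {n : ℕ} (Q : SemiFuzzyQuantifier X n) (A : Fin n → FuzzySet X)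
    (γ : ℝ) : 0 ≤ botVal Q A γ ∧ botVal Q A γ ≤ 1 := by
  have h0 : ∀ r ∈ cutValues Q A γ, 0 ≤ r := by
    rintro r ⟨B, -, rfl⟩
    exact (Q B).2.1
  refine ⟨Real.sInf_nonneg h0, ?_⟩
  unfold botVal
  rcases (cutValues Q A γ).eq_empty_or_nonempty with h | ⟨r, hr⟩
  · simp [h]
  · refine (csInf_le ⟨0, h0⟩ hr).trans ?_
    obtain ⟨B, -, rfl⟩ := hr
    exact (Q B).2.2

/-- The QFM `F_owa(Q)(A) = ∫₀¹ (⊤(γ) + ⊥(γ)) / 2 dγ`. -/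
def Fowa : QFM.{u} where
  app {X} _ _ n Q A :=
    ⟨∫ γ in (0 : ℝ)..1, (topVal Q A γ + botVal Q A γ) / 2, by
      constructor
      · apply intervalIntegral.integral_nonneg zero_le_one
        intro γ _
        have := topVal_mem Q A γ
        have := botVal_mem Q A γ
        linarith
      · have h : ‖∫ γ in (0 : ℝ)..1, (topVal Q A γ + botVal Q A γ) / 2‖ ≤ 1 * |(1 : ℝ) - 0| := by
          apply intervalIntegral.norm_integral_le_of_norm_le_const
          intro γ _
          have := topVal_mem Q A γ
          have := botVal_mem Q A γ
          rw [Real.norm_eq_abs, abs_le]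
          constructor <;> linarith
        have h2 := (le_abs_self _).trans h
        simpa using h2⟩

end FuzzyQuant

end

namespace FuzzyQuant

open scoped Classical unitInterval

/-! ### Determiner fuzzification schemes are monotone in the quantifier -/

/-! Both parts rest on the crisp inequality `propBinary Λ c ≤ propImp Λ`: adding `|Aᶜ|` to the
numerator and denominator of a fraction at most one cannot decrease it, and for empty `A` the
implication-based value is `Λ(1) = 1`, whatever `c` is.

For (a) it remains to see that a DFS is monotone in the quantifier, although its axioms give
monotonicity only in an argument. The inequality `Q ≤ Q'` is encoded as antitonicity in an auxiliary
argument, which selects `Q'` when empty and `Q` otherwise; fuzzy values `0` and `1` of that argument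
recover `F(Q')` and `F(Q)`. Binary quantifiers reduce to unary ones on `X ⊕ X`.

For (b), the Choquet integral is the integral over `[0,1]` of the measure of the level sets `{f ≥
t}`. Folding it at `t = 1/2` by `t = (1 ∓ γ)/2` gives an integrand that dominates that of `Fowa` for
every `γ > 0`. -/

theorem truthVal_true {p : Prop} (h : p) : truthVal p = 1 := if_pos h

theorem truthVal_false {p : Prop} (h : ¬ p) : truthVal p = 0 := if_neg h

theorem crisp_empty {X : Type u} : crisp (∅ : Set X) = fun _ => 0 :=
  funext fun _ => truthVal_false (Set.notMem_empty _)

theorem crisp_univ {X : Type u} : crisp (Set.univ : Set X) = fun _ => 1 :=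
  funext fun _ => truthVal_true (Set.mem_univ _)

namespace QFM.IsDFS

variable {F : QFM.{u}} (hF : F.IsDFS) {X X' : Type u} [Finite X] [Nonempty X] [Finite X']
  [Nonempty X']

include hF

/-- A constant quantifier is non-increasing, so its value at any fuzzy set is squeezed between its
values at the crisp sets `∅` and `univ`. -/
theorem app_const (c : I) (A : Fin 1 → FuzzySet X) : F.app (fun _ => c) A = c := by
  have upd : ∀ B : FuzzySet X, Function.update A (Fin.last 0) B = fun _ => B := fun B => by
    funext i; rw [Subsingleton.elim i (Fin.last 0), Function.update_self]
  have key : ∀ B C : FuzzySet X, B ≤ C →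
      F.app (fun _ : Fin 1 → Set X => c) (fun _ => C) ≤
        F.app (fun _ : Fin 1 → Set X => c) (fun _ => B) := by
    intro B C h
    have := hF.preserves_monotonicity (n := 0) (fun _ : Fin 1 → Set X => c)
      (fun _ _ _ _ => le_rfl) A B C h
    rwa [upd, upd] at this
  have hA : A = fun _ => A 0 := funext fun i => by rw [Subsingleton.elim i 0]
  have h0 := hF.correct_generalisation le_rfl (fun _ : Fin 1 → Set X => c) (fun _ => ∅)
  have h1 := hF.correct_generalisation le_rfl (fun _ : Fin 1 → Set X => c) (fun _ => Set.univ)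
  rw [crisp_empty] at h0
  rw [crisp_univ] at h1
  rw [hA]
  exact le_antisymm ((key _ _ fun _ => unitInterval.nonneg').trans_eq h0)
    (h1.symm.trans_le (key _ _ fun _ => unitInterval.le_one'))

theorem image_apply_of_injective {Z : Type u} {f : X → Z} (hf : f.Injective) (A : FuzzySet X)
    (x : X) :
    F.image f A (f x) = A x := by
  unfold image
  simp only [hf.mem_set_image]
  exact hF.projection x _

theorem image_apply_of_notMem_range {Z : Type u} {f : X → Z} (A : FuzzySet X) {y : Z}
    (hy : y ∉ Set.range f) : F.image f A y = 0 := by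
  unfold image
  have : ∀ S : Set X, truthVal (y ∈ f '' S) = 0 := fun S =>
    truthVal_false fun h => hy (Set.image_subset_range _ _ h)
  simp only [this]
  exact hF.app_const 0 _

theorem app_comp_image (Q : SemiFuzzyQuantifier X 1) (f : X' → X) (A : FuzzySet X') :
    F.app (fun Y : Fin 1 → Set X' => Q (fun _ => f '' Y 0)) (fun _ => A) =
      F.app Q (fun _ => F.image f A) := by
  rw [← hF.functional_application Q (fun _ => f) (fun _ => A)]
  congr 1
  funext Y
  congr 1
  funext i
  rw [Subsingleton.elim i 0]

/-! ### Induced negation and disjunction. -/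

theorem neg_zero : F.neg 0 = 1 := by
  have := hF.correct_generalisation (X := ULift.{u} (Fin 1)) le_rfl
    (fun Y : Fin 1 → Set _ => truthVal (¬ ULift.up 0 ∈ Y 0)) (fun _ => ∅)
  rw [crisp_empty, truthVal_true (Set.notMem_empty _)] at this
  rw [← this]
  unfold neg truthFun
  congr 1
  funext i e
  rw [Subsingleton.elim e.down 0]
  rfl

theorem neg_one : F.neg 1 = 0 := by
  have := hF.correct_generalisation (X := ULift.{u} (Fin 1)) le_rfl
    (fun Y : Fin 1 → Set _ => truthVal (¬ ULift.up 0 ∈ Y 0)) (fun _ => Set.univ)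
  rw [crisp_univ, truthVal_false (not_not_intro (Set.mem_univ _))] at this
  rw [← this]
  unfold neg truthFun
  congr 1
  funext i e
  rw [Subsingleton.elim e.down 0]
  rfl

/-- On a one-point set the projection quantifier is its own dual, so dualisation returns its
argument negated twice. -/
theorem neg_neg (x : I) : F.neg (F.neg x) = x := by
  have h := hF.dualisation (X := ULift.{u} (Fin 1)) (n := 0)
    (fun Y => truthVal (ULift.up 0 ∈ Y 0)) (fun _ _ => x)
  have h1 : (fun Y : Fin 1 → Set (ULift.{u} (Fin 1)) => F.neg (truthVal (ULift.up 0 ∈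
      Function.update Y (Fin.last 0) (Y (Fin.last 0))ᶜ 0))) =
      fun Y => truthVal (ULift.up 0 ∈ Y 0) := by
    funext Y
    by_cases hY : ULift.up 0 ∈ Y 0
    · rw [truthVal_true hY, truthVal_false, hF.neg_zero]
      simpa using hY
    · rw [truthVal_false hY, truthVal_true, hF.neg_one]
      simpa using hY
  rw [h1, hF.projection, hF.projection] at h
  exact h.symm

theorem neg_injective : Function.Injective F.neg :=
  Function.LeftInverse.injective hF.neg_neg

/-- The argument with a single possibly nonzero entry is the fuzzy image of a one-point set; pulled
back along that injection, disjunction becomes a projection quantifier. -/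
theorem disj_image (x : I) (i : Fin 2) :
    F.truthFun (n := 2) (fun p => truthVal (p 0 ∨ p 1)) (fun j => if j = i then x else 0) = x := by
  have hinj : Function.Injective
      (fun _ : ULift.{u} (Fin 1) => (ULift.up i : ULift.{u} (Fin 2))) :=
    Function.injective_of_subsingleton _
  have h := hF.app_comp_image
    (fun Y : Fin 1 → Set (ULift.{u} (Fin 2)) => truthVal (ULift.up 0 ∈ Y 0 ∨ ULift.up 1 ∈ Y 0))
    (fun _ : ULift.{u} (Fin 1) => (ULift.up i : ULift.{u} (Fin 2))) (fun _ => x)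
  have himg : F.image (fun _ : ULift.{u} (Fin 1) => (ULift.up i : ULift.{u} (Fin 2)))
      (fun _ => x) = fun e => if e.down = i then x else 0 := by
    funext e
    by_cases he : e.down = i
    · subst he
      rw [if_pos rfl]
      exact hF.image_apply_of_injective hinj (fun _ => x) (ULift.up 0)
    · rw [if_neg he]
      refine hF.image_apply_of_notMem_range _ ?_
      rintro ⟨_, rfl⟩
      exact he rfl
  rw [himg] at h
  refine h.symm.trans ?_
  have hQ : (fun Y : Fin 1 → Set (ULift.{u} (Fin 1)) =>
      truthVal (ULift.up 0 ∈ (fun _ : ULift.{u} (Fin 1) => (ULift.up i : ULift.{u} (Fin 2))) '' Y 0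
        ∨ ULift.up 1 ∈ (fun _ : ULift.{u} (Fin 1) => (ULift.up i : ULift.{u} (Fin 2))) '' Y 0)) =
      fun Y => truthVal (ULift.up 0 ∈ Y 0) := by
    funext Y
    congr 1
    apply propext
    constructor
    · rintro (⟨e, he, -⟩ | ⟨e, he, -⟩) <;> rwa [Subsingleton.elim (ULift.up 0) e]
    · intro he
      have : i = 0 ∨ i = 1 := by omega
      rcases this with rfl | rfl
      exacts [Or.inl ⟨_, he, rfl⟩, Or.inr ⟨_, he, rfl⟩]
  rw [hQ]
  exact hF.projection _ _

theorem disj_zero_right (x : I) : F.disj x 0 = x := by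
  refine Eq.trans ?_ (hF.disj_image x 0)
  unfold disj
  congr 1
  funext j
  fin_cases j <;> simp

theorem disj_zero_left (x : I) : F.disj 0 x = x := by
  refine Eq.trans ?_ (hF.disj_image x 1)
  unfold disj
  congr 1
  funext j
  fin_cases j <;> simp

/-! ### Changing the arity, and inserting crisp arguments. -/

theorem app_union (Q : SemiFuzzyQuantifier X 1) (A B : FuzzySet X) :
    F.app (fun Y : Fin 2 → Set X => Q (fun _ => Y 0 ∪ Y 1)) ![A, B] =
      F.app Q (fun _ => F.union A B) := by
  have h := hF.internal_joins (n := 0) Q ![A, B]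
  have h1 : ∀ (α : Type u) (f : Fin 1 → α) (a : α),
      Function.update f (Fin.last 0) a = fun _ => a := fun α f a => by
    funext i; rw [Subsingleton.elim i (Fin.last 0), Function.update_self]
  simp only [h1] at h
  exact h

/-- A binary quantifier on `X` is a unary quantifier on the disjoint union of two copies
of `X`. -/
theorem app_binary_eq_unary (Q : SemiFuzzyQuantifier X 2) (A B : FuzzySet X) :
    F.app Q ![A, B] =
      F.app (X := X ⊕ X) (fun Y : Fin 1 → Set (X ⊕ X) => Q ![Sum.inl ⁻¹' Y 0, Sum.inr ⁻¹' Y 0])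
        (fun _ => Sum.elim A B) := by
  have hU : F.union (F.image Sum.inl A) (F.image Sum.inr B) = Sum.elim A B := by
    funext z
    unfold union
    rcases z with x | x
    · rw [hF.image_apply_of_injective Sum.inl_injective,
        hF.image_apply_of_notMem_range B (by simp), hF.disj_zero_right]
      rfl
    · rw [hF.image_apply_of_injective Sum.inr_injective,
        hF.image_apply_of_notMem_range A (by simp), hF.disj_zero_left]
      rfl
  rw [← hU, ← hF.app_union]
  have h := hF.functional_application (X := X ⊕ X)
    (fun Y : Fin 2 → Set (X ⊕ X) => Q ![Sum.inl ⁻¹' (Y 0 ∪ Y 1), Sum.inr ⁻¹' (Y 0 ∪ Y 1)])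
    ![Sum.inl, Sum.inr] ![A, B]
  have hA : (fun i => F.image ((![Sum.inl, Sum.inr] : Fin 2 → X → X ⊕ X) i)
      ((![A, B] : Fin 2 → FuzzySet X) i)) = ![F.image Sum.inl A, F.image Sum.inr B] := by
    funext i
    fin_cases i <;> rfl
  rw [hA] at h
  rw [← h]
  congr 1
  funext Y
  congr 1
  funext i
  have hl : (Sum.inl : X → X ⊕ X) ⁻¹' (Sum.inr '' Y 1) = ∅ := by ext; simp
  have hr : (Sum.inr : X → X ⊕ X) ⁻¹' (Sum.inl '' Y 0) = ∅ := by ext; simp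
  fin_cases i
  · simp [hl, Set.preimage_image_eq _ Sum.inl_injective]
  · simp [hr, Set.preimage_image_eq _ Sum.inr_injective]

/-- On `X ⊕ X`, padding `A` with zeros is the fuzzy image of `A` under `Sum.inl`, so functional
application removes the second block. -/
theorem app_insert_empty (V : SemiFuzzyQuantifier X 2) (A : FuzzySet X) :
    F.app V ![A, fun _ => 0] =
      F.app (fun Y : Fin 1 → Set X => V ![Y 0, ∅]) (fun _ => A) := by
  have himg : F.image (Sum.inl : X → X ⊕ X) A = Sum.elim A (fun _ => 0) := by
    funext z
    rcases z with x | x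
    · exact hF.image_apply_of_injective Sum.inl_injective A x
    · exact hF.image_apply_of_notMem_range A (by simp)
  rw [hF.app_binary_eq_unary, ← himg, ← hF.app_comp_image]
  congr 1
  funext Y
  congr 1
  funext i
  have hr : (Sum.inr : X → X ⊕ X) ⁻¹' (Sum.inl '' Y 0) = ∅ := by ext; simp
  fin_cases i
  · simp [Set.preimage_image_eq _ Sum.inl_injective]
  · simp [hr]

theorem app_antitone_right {V : SemiFuzzyQuantifier X 2}
    (hV : ∀ Y S T : Set X, S ⊆ T → V ![Y, T] ≤ V ![Y, S]) (A : FuzzySet X) {B C : FuzzySet X}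
    (hBC : B ≤ C) : F.app V ![A, C] ≤ F.app V ![A, B] := by
  have h1 : ∀ (α : Type u) (f : Fin 2 → α) (a : α),
      Function.update f (Fin.last 1) a = ![f 0, a] := fun α f a => by
    funext i
    fin_cases i <;> simp [Function.update, Fin.last]
  have h := hF.preserves_monotonicity (n := 1) V (fun Y S T hST => by
    rw [h1, h1]; exact hV _ _ _ hST) ![A, B] B C hBC
  rwa [h1, h1] at h

theorem app_dual (Q : SemiFuzzyQuantifier X 1) (A : FuzzySet X) :
    F.app (fun Y : Fin 1 → Set X => F.neg (Q fun _ => (Y 0)ᶜ)) (fun _ => A) =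
      F.neg (F.app Q (fun _ => F.compl A)) := by
  have h1 : ∀ (α : Type u) (f : Fin 1 → α) (a : α),
      Function.update f (Fin.last 0) a = fun _ => a := fun α f a => by
    funext i; rw [Subsingleton.elim i (Fin.last 0), Function.update_self]
  have h := hF.dualisation (n := 0) Q (fun _ => A)
  simp only [h1] at h
  exact h

theorem compl_compl {Z : Type u} (A : FuzzySet Z) : F.compl (F.compl A) = A :=
  funext fun _ => hF.neg_neg _

/-- Images pad only with zeros; padding with ones is obtained by conjugating with the involutive
complement. Negating both sides brings them into the form of the dualisation axiom. -/
theorem app_insert_univ (V : SemiFuzzyQuantifier X 2) (A : FuzzySet X) :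
    F.app V ![A, fun _ => 1] =
      F.app (fun Y : Fin 1 → Set X => V ![Y 0, Set.univ]) (fun _ => A) := by
  have himg : F.image (Sum.inl : X → X ⊕ X) (F.compl A) =
      Sum.elim (F.compl A) (fun _ => 0) := by
    funext z
    rcases z with x | x
    · exact hF.image_apply_of_injective Sum.inl_injective _ x
    · exact hF.image_apply_of_notMem_range _ (by simp)
  have hc : F.compl (Sum.elim (F.compl A) (fun _ : X => 0)) = Sum.elim A (fun _ => 1) := by
    funext z
    rcases z with x | x
    exacts [hF.neg_neg _, hF.neg_zero]
  apply hF.neg_injective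
  rw [hF.app_binary_eq_unary, ← hc, ← hF.app_dual, ← himg, ← hF.app_comp_image,
    ← hF.compl_compl A, ← hF.app_dual, hF.compl_compl A]
  congr 1
  funext Y
  congr 2
  funext i
  have hl : (Sum.inl : X → X ⊕ X) ⁻¹' (Sum.inl '' Y 0)ᶜ = (Y 0)ᶜ := by ext; simp
  have hr : (Sum.inr : X → X ⊕ X) ⁻¹' (Sum.inl '' Y 0)ᶜ = Set.univ := by ext; simp
  fin_cases i
  exacts [hl, hr]

theorem app_mono_unary {Q Q' : SemiFuzzyQuantifier X 1} (hQ : Q ≤ Q') (A : FuzzySet X) :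
    F.app Q (fun _ => A) ≤ F.app Q' (fun _ => A) := by
  have hcan : ∀ Q : SemiFuzzyQuantifier X 1, (fun Y => Q (fun _ => Y 0)) = Q := fun Q => by
    funext Y
    congr 1
    funext i
    rw [Subsingleton.elim i 0]
  -- Enlarging the second argument can only switch the value from `Q'` down to `Q`, so `V` is
  -- antitone there.
  let V : SemiFuzzyQuantifier X 2 := fun Y =>
    if Y 1 = ∅ then Q' (fun _ => Y 0) else Q (fun _ => Y 0)
  have h := hF.app_antitone_right (V := V) (fun Y S T hST => by
    change (if T = ∅ then Q' (fun _ => Y) else Q (fun _ => Y)) ≤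
      (if S = ∅ then Q' (fun _ => Y) else Q (fun _ => Y))
    by_cases hT : T = ∅
    · rw [if_pos hT, if_pos (Set.subset_eq_empty hST hT)]
    · rw [if_neg hT]
      split_ifs
      exacts [hQ _, le_rfl]) A (B := fun _ => 0) (C := fun _ => 1)
      (fun _ => unitInterval.nonneg')
  rw [hF.app_insert_univ, hF.app_insert_empty] at h
  simpa [V, hcan] using h

theorem app_mono_binary {Q Q' : SemiFuzzyQuantifier X 2} (hQ : Q ≤ Q') (A B : FuzzySet X) :
    F.app Q ![A, B] ≤ F.app Q' ![A, B] := by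
  rw [hF.app_binary_eq_unary, hF.app_binary_eq_unary]
  exact hF.app_mono_unary (fun _ => hQ _) _

end QFM.IsDFS

/-! ### The Choquet integral as an integral over cuts -/

theorem propUnary_mono {X : Type u} [Finite X] (Λ : RIMQuantifier) {S T : Set X} (h : S ⊆ T) :
    propUnary Λ S ≤ propUnary Λ T := by
  apply Λ.monotone
  change (S.ncard : ℝ) / (Nat.card X : ℝ) ≤ (T.ncard : ℝ) / (Nat.card X : ℝ)
  have : (S.ncard : ℝ) ≤ T.ncard := by exact_mod_cast Set.ncard_le_ncard h
  gcongr

theorem propUnary_empty {X : Type u} [Finite X] (Λ : RIMQuantifier) : propUnary Λ (∅ : Set X) = 0 := by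
  have : frac (∅ : Set X).ncard (Nat.card X) (Set.ncard_le_card _) = 0 := by
    apply Subtype.ext
    simp [frac]
  rw [propUnary, this, Λ.map_zero]

theorem antitone_cut {X : Type u} {μ : Set X → I} (hμ : Monotone μ) (f : X → ℝ) :
    Antitone fun t : ℝ => (μ {x | t ≤ f x} : ℝ) :=
  fun _ _ hst => hμ fun _ hx => hst.trans hx

theorem choquet_eq_integral {X : Type u} [Finite X] {μ : Set X → I} (hμ : Monotone μ)
    (hμ0 : μ ∅ = 0) {f : X → ℝ} (hf0 : ∀ x, 0 ≤ f x) {b : ℝ} (hb : ∀ x, f x ≤ b) (hb0 : 0 ≤ b) :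
    choquet μ f = ∫ t in (0 : ℝ)..b, (μ {x | t ≤ f x} : ℝ) := by
  set N := Nat.card X
  set e := sortedEnum f
  have he : Monotone (f ∘ e) := monotone_sortedEnum f
  -- The sorted values shifted by one, so that `a 0 = 0` matches the convention `f(x₀) := 0`; the
  -- final default is never reached for `k ≤ N`.
  let a : ℕ → ℝ := fun k => if k = 0 then 0 else if h : k - 1 < N then f (e ⟨k - 1, h⟩) else 0
  have ha0 : a 0 = 0 := rfl
  have ha : ∀ i : Fin N, a (i + 1) = f (e i) := fun i => by simp [a]
  have hint : ∀ s t : ℝ, IntervalIntegrable (fun t : ℝ => (μ {x | t ≤ f x} : ℝ))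
      MeasureTheory.volume s t := fun s t => (antitone_cut hμ f).intervalIntegrable
  have hsum := intervalIntegral.sum_integral_adjacent_intervals (a := a) (n := N)
    (f := fun t : ℝ => (μ {x | t ≤ f x} : ℝ)) (μ := MeasureTheory.volume)
    fun k _ => hint _ _
  have hle : ∀ x, f x ≤ a N := by
    intro x
    have hN : 0 < N := (e.symm x).pos
    have h1 := ha ⟨N - 1, by omega⟩
    have h2 : N - 1 + 1 = N := by omega
    simp only [h2] at h1
    rw [h1, ← e.apply_symm_apply x]
    exact he (Fin.le_def.2 (by simp only; omega))
  -- Above the largest value of `f` the level sets are empty.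
  have hlast : ∫ t in a N..b, (μ {x | t ≤ f x} : ℝ) = 0 := by
    have haN : a N ≤ b := by
      by_cases hN : N = 0
      · rw [hN, ha0]; exact hb0
      · have h1 := ha ⟨N - 1, by omega⟩
        have h2 : N - 1 + 1 = N := by omega
        simp only [h2] at h1
        rw [h1]; exact hb _
    rw [intervalIntegral.integral_congr_ae (g := fun _ => (0 : ℝ))]
    · simp
    · refine Filter.Eventually.of_forall fun t ht => ?_
      rw [Set.uIoc_of_le haN] at ht
      have : {x | t ≤ f x} = ∅ :=
        Set.eq_empty_of_forall_notMem fun x hx => absurd (ht.1.trans_le hx) (hle x).not_gt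
      rw [this, hμ0]; rfl
  rw [← intervalIntegral.integral_add_adjacent_intervals (hint 0 (a N)) (hint (a N) b), hlast,
    add_zero, ← ha0, ← hsum, ← Fin.sum_univ_eq_sum_range
      (fun k => ∫ t in a k..a (k + 1), (μ {x | t ≤ f x} : ℝ)), choquet]
  refine Finset.sum_congr rfl fun i _ => ?_
  have hprev : (if i.val = 0 then 0 else f (e ⟨i.val - 1, by omega⟩)) = a i := by
    by_cases hi : i.val = 0
    · simp [a, hi]
    · have : i.val - 1 < N := by omega
      simp [a, hi, this]
  have hai : a i ≤ f (e i) := by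
    rw [← hprev]
    split_ifs
    · exact hf0 _
    · exact he (Fin.le_def.2 (by simp))
  rw [hprev, ha i, intervalIntegral.integral_congr_ae (g := fun _ => (μ (e '' Set.Ici i) : ℝ))]
  · rw [intervalIntegral.integral_const, smul_eq_mul, mul_comm]
  -- On the half-open interval `(a i, f (e i)]` the level set is exactly the tail from `i`; if
  -- values are tied, the interval is empty.
  · refine Filter.Eventually.of_forall fun t ht => ?_
    rw [Set.uIoc_of_le hai] at ht
    have : {x | t ≤ f x} = e '' Set.Ici i := by
      ext x
      obtain ⟨j, rfl⟩ := e.surjective x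
      rw [e.injective.mem_set_image, Set.mem_Ici, Set.mem_ofPred_eq]
      refine ⟨fun h => ?_, fun h => ht.2.trans (he h)⟩
      by_contra! hji
      have hi : i.val ≠ 0 := by have := Fin.lt_def.1 hji; omega
      rw [← hprev, if_neg hi] at ht
      have : f (e j) ≤ f (e ⟨i.val - 1, by omega⟩) :=
        he (Fin.le_def.2 (by have := Fin.lt_def.1 hji; simp only; omega))
      linarith [ht.1]
    rw [this]

/-! ### Comparison of the two binary quantifiers and of the models -/

theorem propImp_eq_propUnary {X : Type u} [Finite X] (Λ : RIMQuantifier) (Y : Fin 2 → Set X) :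
    propImp Λ Y = propUnary Λ ((Y 0)ᶜ ∪ Y 1) := by
  have h : ((Y 0)ᶜ ∪ Y 1).ncard = (Y 0)ᶜ.ncard + (Y 0 ∩ Y 1).ncard := by
    have hd : Disjoint (Y 0)ᶜ (Y 0 ∩ Y 1) := disjoint_compl_left.mono_right Set.inter_subset_left
    rw [← Set.ncard_union_eq hd]
    congr 1
    ext x
    simp only [Set.mem_union, Set.mem_compl_iff, Set.mem_inter_iff]
    tauto
  unfold propImp propUnary
  simp only [h]

theorem propBinary_le_propImp {X : Type u} [Finite X] [Nonempty X] (Λ : RIMQuantifier) (c : I) :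
    propBinary (X := X) Λ c ≤ propImp Λ := by
  intro Y
  unfold propBinary propImp
  have hsum := Set.ncard_add_ncard_compl (Y 0)
  split_ifs with hY
  · have : ∀ h, frac ((Y 0)ᶜ.ncard + (Y 0 ∩ Y 1).ncard) (Nat.card X) h = 1 := fun h => by
      apply Subtype.ext
      simp [frac, hY, Set.ncard_univ]
    rw [this, Λ.map_one]
    exact unitInterval.le_one'
  · apply Λ.monotone
    have hle : (Y 0 ∩ Y 1).ncard ≤ (Y 0).ncard := Set.ncard_le_ncard Set.inter_subset_left
    have hpos : 0 < (Y 0).ncard := (Set.ncard_pos).2 (Set.nonempty_iff_ne_empty.2 hY)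
    change ((Y 0 ∩ Y 1).ncard : ℝ) / ((Y 0).ncard : ℝ) ≤
      (((Y 0)ᶜ.ncard + (Y 0 ∩ Y 1).ncard : ℕ) : ℝ) / (Nat.card X : ℝ)
    rw [div_le_div_iff₀ (by exact_mod_cast hpos) (by exact_mod_cast Nat.card_pos), ← hsum]
    norm_cast
    -- After cross-multiplication and cancellation, `|A ∩ B| · |Aᶜ| ≤ |A| · |Aᶜ|` remains.
    nlinarith [Nat.mul_le_mul_right (Y 0)ᶜ.ncard hle]

/-! ### Three-valued cuts against level sets of the Kleene–Dienes implication. -/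

theorem cutMin_subset_cutMax {X : Type u} (A : FuzzySet X) {γ : ℝ} (hγ : 0 < γ) :
    cutMin A γ ⊆ cutMax A γ := by
  intro x hx
  simp only [cutMin, cutMax, if_pos hγ, Set.mem_ofPred_eq] at hx ⊢
  linarith

theorem coe_kleeneDienes (x y : I) : (kleeneDienes x y : ℝ) = max (1 - (x : ℝ)) y := by
  unfold kleeneDienes
  rw [(Subtype.mono_coe (· ∈ Set.Icc (0 : ℝ) 1)).map_max, unitInterval.coe_symm_eq]

/-- For admissible `Y`, a point of `(Y 0)ᶜ ∪ Y 1` has `A x < (1 + γ)/2` or `B x > (1 - γ)/2`; either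
puts the implication above `(1 - γ)/2`. -/
theorem topVal_le_kleeneDienes {X : Type u} [Finite X] [Nonempty X] (Λ : RIMQuantifier) (c : I)
    (A B : FuzzySet X) {γ : ℝ} (hγ : 0 < γ) :
    topVal (propBinary Λ c) ![A, B] γ ≤
      (propUnary Λ {x | (1 - γ) / 2 ≤ (kleeneDienes (A x) (B x) : ℝ)} : ℝ) := by
  refine Real.sSup_le ?_ (unitInterval.nonneg _)
  rintro r ⟨Y, hY, rfl⟩
  refine (propBinary_le_propImp Λ c Y).trans ?_
  rw [propImp_eq_propUnary]
  refine propUnary_mono Λ ?_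
  rintro x (hx | hx)
  · have h : x ∉ cutMin A γ := fun h => hx ((hY 0).1 h)
    simp only [cutMin, if_pos hγ, Set.mem_ofPred_eq, not_le] at h
    rw [Set.mem_ofPred_eq, coe_kleeneDienes]
    exact le_max_of_le_left (by linarith)
  · have h : x ∈ cutMax B γ := (hY 1).2 hx
    simp only [cutMax, if_pos hγ, Set.mem_ofPred_eq] at h
    rw [Set.mem_ofPred_eq, coe_kleeneDienes]
    exact le_max_of_le_right h.le

theorem botVal_le_kleeneDienes {X : Type u} [Finite X] [Nonempty X] (Λ : RIMQuantifier) (c : I)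
    (A B : FuzzySet X) {γ : ℝ} (hγ : 0 < γ) :
    botVal (propBinary Λ c) ![A, B] γ ≤
      (propUnary Λ {x | (1 + γ) / 2 ≤ (kleeneDienes (A x) (B x) : ℝ)} : ℝ) := by
  -- The largest admissible first set and smallest second set make `(Y 0)ᶜ ∪ Y 1` as small as
  -- possible.
  have hmem : (propBinary Λ c ![cutMax A γ, cutMin B γ] : ℝ) ∈
      cutValues (propBinary Λ c) ![A, B] γ := by
    refine ⟨_, fun i => ?_, rfl⟩
    fin_cases i
    exacts [⟨cutMin_subset_cutMax A hγ, subset_rfl⟩, ⟨subset_rfl, cutMin_subset_cutMax B hγ⟩]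
  refine (csInf_le ⟨0, ?_⟩ hmem).trans ?_
  · rintro r ⟨Y, -, rfl⟩
    exact (unitInterval.nonneg _)
  refine (propBinary_le_propImp Λ c _).trans ?_
  rw [propImp_eq_propUnary]
  refine propUnary_mono Λ ?_
  rintro x (hx | hx)
  · have h : x ∉ cutMax A γ := hx
    simp only [cutMax, if_pos hγ, Set.mem_ofPred_eq, not_lt] at h
    rw [Set.mem_ofPred_eq, coe_kleeneDienes]
    exact le_max_of_le_left (by linarith)
  · have h : x ∈ cutMin B γ := hx
    simp only [cutMin, if_pos hγ, Set.mem_ofPred_eq] at h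
    rw [Set.mem_ofPred_eq, coe_kleeneDienes]
    exact le_max_of_le_right h

theorem integral_symmetric_halves {g : ℝ → ℝ} (hg : Antitone g) :
    ∫ γ in (0 : ℝ)..1, (g ((1 - γ) / 2) + g ((1 + γ) / 2)) / 2 = ∫ t in (0 : ℝ)..1, g t := by
  have h1 : Monotone fun γ : ℝ => g ((1 - γ) / 2) := fun s t hst => hg (by linarith)
  have h2 : Antitone fun γ : ℝ => g ((1 + γ) / 2) := fun s t hst => hg (by linarith)
  have e1 : ∫ γ in (0 : ℝ)..1, g ((1 - γ) / 2) = 2 * ∫ t in (0 : ℝ)..(1 / 2), g t := by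
    have := intervalIntegral.integral_comp_sub_mul (a := 0) (b := 1) g
      (c := (1 / 2 : ℝ)) (by norm_num) (1 / 2)
    convert this using 2
    · funext γ; congr 1; ring
    all_goals norm_num
  have e2 : ∫ γ in (0 : ℝ)..1, g ((1 + γ) / 2) = 2 * ∫ t in (1 / 2 : ℝ)..1, g t := by
    have := intervalIntegral.integral_comp_add_mul (a := 0) (b := 1) g
      (c := (1 / 2 : ℝ)) (by norm_num) (1 / 2)
    convert this using 2
    · funext γ; congr 1; ring
    all_goals norm_num
  rw [intervalIntegral.integral_div,
    intervalIntegral.integral_add h1.intervalIntegrable h2.intervalIntegrable, e1, e2,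
    ← intervalIntegral.integral_add_adjacent_intervals (a := 0) (b := 1 / 2) (c := 1)
      hg.intervalIntegrable hg.intervalIntegrable]
  ring

theorem Fowa_propBinary_le_yagerBinary {X : Type u} [Finite X] [Nonempty X] (Λ : RIMQuantifier)
    (c : I) (A B : FuzzySet X) :
    (Fowa.{u}.app (propBinary Λ c) ![A, B] : ℝ) ≤ yagerBinary kleeneDienes Λ A B := by
  have hμ : Monotone (propUnary (X := X) Λ) := fun _ _ => propUnary_mono Λ
  have hg := antitone_cut hμ fun x => (kleeneDienes (A x) (B x) : ℝ)
  rw [yagerBinary, yagerUnary, choquet_eq_integral hμ (propUnary_empty Λ)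
    (fun x => unitInterval.nonneg _) (b := 1) (fun x => unitInterval.le_one _) zero_le_one,
    ← integral_symmetric_halves hg]
  change ∫ γ in (0 : ℝ)..1, _ ≤ _
  have h1 : Monotone fun γ : ℝ =>
      (propUnary Λ {x | (1 - γ) / 2 ≤ (kleeneDienes (A x) (B x) : ℝ)} : ℝ) :=
    fun s t hst => hg (by linarith)
  have h2 : Antitone fun γ : ℝ =>
      (propUnary Λ {x | (1 + γ) / 2 ≤ (kleeneDienes (A x) (B x) : ℝ)} : ℝ) :=
    fun s t hst => hg (by linarith)
  have hint := (h1.intervalIntegrable (μ := MeasureTheory.volume) (a := 0) (b := 1)).add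
    (h2.intervalIntegrable (a := 0) (b := 1)) |>.div_const 2
  rw [intervalIntegral.integral_of_le zero_le_one, intervalIntegral.integral_of_le zero_le_one]
  -- This comparison needs integrability of the larger integrand only, so no measurability of
  -- `topVal` and `botVal` is required. Integrating over `(0, 1]` avoids the exceptional cut at `γ =
  -- 0`.
  refine MeasureTheory.integral_mono_of_nonneg ?_ hint.1 ?_
  · refine Filter.Eventually.of_forall fun γ => ?_
    have := topVal_mem (propBinary Λ c) ![A, B] γ
    have := botVal_mem (propBinary Λ c) ![A, B] γ
    change (0 : ℝ) ≤ _
    linarith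
  · filter_upwards [MeasureTheory.ae_restrict_mem measurableSet_Ioc] with γ hγ
    have := topVal_le_kleeneDienes Λ c A B hγ.1
    have := botVal_le_kleeneDienes Λ c A B hγ.1
    linarith

end FuzzyQuant

theorem mainTheorem9 {X : Type u} [Finite X] [Nonempty X] (Λ : FuzzyQuant.RIMQuantifier)
    (c : unitInterval) :
    (∀ F : FuzzyQuant.QFM.{u}, F.IsDFS → ∀ A B : FuzzyQuant.FuzzySet X,
      F.app (FuzzyQuant.propImp Λ) ![A, B] ≥ F.app (FuzzyQuant.propBinary Λ c) ![A, B]) ∧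
    (∀ A B : FuzzyQuant.FuzzySet X,
      FuzzyQuant.yagerBinary FuzzyQuant.kleeneDienes Λ A B ≥
        (FuzzyQuant.Fowa.{u}.app (FuzzyQuant.propBinary Λ c) ![A, B] : ℝ)) :=
  ⟨fun _ hF A B => hF.app_mono_binary (FuzzyQuant.propBinary_le_propImp Λ c) A B,
    fun A B => FuzzyQuant.Fowa_propBinary_le_yagerBinary Λ c A B⟩
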